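/- Throughout, a \emph{normal integral domain} is a Noetherian integral domain that is integrally closed in its field of fractions. For a commutative ring $R$ and an $R$-module $M$ put $M^{*}=\operatorname{Hom}_R(M,R)$ and $M^{**}=(M^{*})^{*}$; a finitely generated $R$-module $M$ is \emph{reflexive} if the natural map $M\to M^{**}$, $m\mapsto(g\mapsto g(m))$, is an isomorphism. For a normal integral domain $A$, the \emph{divisor class group} $\operatorname{Cl}(A)$ is the group of isomorphism classes $[\mathfrak a]$ of finitely generated reflexive $A$-modules $\mathfrak a$ of rank one, with multiplication $[\mathfrak a]\cdot[\mathfrak b]=[(\mathfrak a\otimes_A\mathfrak b)^{**}]$, identity $[A]$ and inverse $[\mathfrak a]^{-1}=[\mathfrak a^{*}]$. \textbf{Theorem.} Let $\varphi\colon A\to B$ be a ring homomorphism of normal integral domains such that, for every prime ideal $P$ of $B$ of height at most one, the localization $A_{\varphi^{-1}(P)}$ is a unique factorization domain. Then for every finitely generated reflexive $A$-module $\mathfrak a$ of rank one, the $B$-module $(\mathfrak a\otimes_A B)^{**}$ (double dual over $B$) is finitely generated, reflexive and of rank one, and there is a unique group homomorphism $\operatorname{Cl}(\varphi)\colon\operatorname{Cl}(A)\to\operatorname{Cl}(B)$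 with $$\operatorname{Cl}(\varphi)([\mathfrak a])=[(\mathfrak a\otimes_A B)^{**}]$$ for all such $\mathfrak a$. -/

import Mathlib

open TensorProduct

universe u v w

namespace DivisorClass

/-- The double dual `Hom_R(Hom_R(M, R), R)` of an `R`-module `M`. -/
abbrev DoubleDual (R : Type*) (M : Type*) [CommRing R] [AddCommGroup M] [Module R M] : Type _ :=
  Module.Dual R (Module.Dual R M)

/-- A finitely generated reflexive `R`-module of rank one (for `R` a domain, `Module.finrank R M`
is the dimension of `Frac(R) ⊗ M` over `Frac(R)`, see `finrank_fractionRing_tensor` below). -/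
structure IsReflexiveRankOne (R : Type*) (M : Type*) [CommRing R] [AddCommGroup M] [Module R M] :
    Prop where
  finite : Module.Finite R M
  reflexive : Module.IsReflexive R M
  rank_one : Module.finrank R M = 1

/-- The set of primes `p` of `R` such that `R_p` is a unique factorization domain. -/
def UFDLocus (R : Type*) [CommRing R] [IsDomain R] : Set (PrimeSpectrum R) :=
  {p | UniqueFactorizationMonoid (Localization.AtPrime p.asIdeal)}

section Rank

variable {R : Type*} [CommRing R] [IsDomain R]
variable {M N : Type*} [AddCommGroup M] [Module R M] [AddCommGroup N] [Module R N]

theorem finrank_fractionRing_tensor :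
    Module.finrank (FractionRing R) (FractionRing R ⊗[R] M) = Module.finrank R M :=
  (TensorProduct.isBaseChange R M (FractionRing R)).finrank_eq

theorem finrank_tensor :
    Module.finrank R (M ⊗[R] N) = Module.finrank R M * Module.finrank R N := by
  rw [← finrank_fractionRing_tensor, ← finrank_fractionRing_tensor (M := M),
    ← finrank_fractionRing_tensor (M := N),
    (AlgebraTensorModule.distribBaseChange R (FractionRing R) M N).finrank_eq,
    Module.finrank_tensorProduct]

theorem isReflexiveRankOne_self : IsReflexiveRankOne R R :=
  ⟨inferInstance, inferInstance, Module.finrank_self R⟩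

theorem isReflexiveRankOne_of_equiv {R : Type*} [CommRing R] {M N : Type*} [AddCommGroup M]
    [Module R M] [AddCommGroup N] [Module R N] (h : IsReflexiveRankOne R M) (e : M ≃ₗ[R] N) :
    IsReflexiveRankOne R N :=
  have := h.finite
  have := h.reflexive
  ⟨Module.Finite.equiv e, Module.equiv e, e.finrank_eq ▸ h.rank_one⟩

variable [IsNoetherianRing R]

theorem finite_dual {R : Type*} [CommRing R] [IsNoetherianRing R] {M : Type*} [AddCommGroup M]
    [Module R M] [Module.Finite R M] : Module.Finite R (Module.Dual R M) := by
  obtain ⟨n, f, hf⟩ := Module.Finite.exists_fin' R M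
  exact Module.Finite.of_injective f.dualMap (LinearMap.dualMap_injective_of_surjective hf)

theorem finrank_dual [Module.Finite R M] :
    Module.finrank R (Module.Dual R M) = Module.finrank R M := by
  have := Module.finitePresentation_of_finite R M
  let S := nonZeroDivisors R
  let K := FractionRing R
  let f : M →ₗ[R] K ⊗[R] M := TensorProduct.mk R K M 1
  have hf : IsLocalizedModule S f :=
    (isLocalizedModule_iff_isBaseChange S K f).2 (TensorProduct.isBaseChange R M K)
  have h := IsLocalizedModule.finrank_eq (p := S)
    (f := IsLocalizedModule.mapExtendScalars S f (Algebra.linearMap R K) K) le_rfl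
  rw [← finrank_fractionRing_tensor (M := M)]
  rw [← Subspace.dual_finrank_eq, IsFractionRing.finrank_right_eq R (FractionRing R)]
  exact h.symm

/-- The dual of a finitely generated module over a Noetherian domain is reflexive. -/
theorem isReflexive_dual [Module.Finite R M] : Module.IsReflexive R (Module.Dual R M) := by
  have := finite_dual (R := R) (M := M)
  have := finite_dual (R := R) (M := Module.Dual R M)
  have := finite_dual (R := R) (M := DoubleDual R M)
  let D := Module.Dual R M
  let e : D →ₗ[R] DoubleDual R D := Module.Dual.eval R D
  let s : DoubleDual R D →ₗ[R] D := (Module.Dual.eval R M).dualMap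
  have hse : ∀ x, s (e x) = x := fun x => by ext m; rfl
  have hs : Function.Surjective s := fun x => ⟨e x, hse x⟩
  have hker : Module.finrank R (LinearMap.ker s) = 0 := by
    have h1 := Submodule.finrank_quotient_add_finrank (LinearMap.ker s)
    rw [(s.quotKerEquivOfSurjective hs).finrank_eq] at h1
    have h2 : Module.finrank R (DoubleDual R D) = Module.finrank R D := by
      rw [finrank_dual, finrank_dual]
    omega
  have hinj : Function.Injective s := by
    rw [← LinearMap.ker_eq_bot, ← Submodule.subsingleton_iff_eq_bot]
    exact Module.finrank_zero_iff.1 hker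
  refine ⟨⟨fun x y h => ?_, fun x => ⟨s x, hinj (hse _)⟩⟩⟩
  rw [← hse x, ← hse y]
  exact congrArg s h

theorem isReflexiveRankOne_dual [Module.Finite R M] (h : Module.finrank R M = 1) :
    IsReflexiveRankOne R (Module.Dual R M) :=
  ⟨finite_dual, isReflexive_dual, finrank_dual.trans h⟩

theorem isReflexiveRankOne_doubleDual [Module.Finite R M] (h : Module.finrank R M = 1) :
    IsReflexiveRankOne R (DoubleDual R M) :=
  have h' := isReflexiveRankOne_dual h
  have := h'.finite
  isReflexiveRankOne_dual h'.rank_one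

/-- The dual of `M ⊗ N` does not change when `M` is replaced by its double dual. -/
noncomputable def dualDoubleDualTensor [Module.Finite R M] :
    Module.Dual R (DoubleDual R M ⊗[R] N) ≃ₗ[R] Module.Dual R (M ⊗[R] N) :=
  have := isReflexive_dual (R := R) (M := M)
  (TensorProduct.comm R N (DoubleDual R M)).dualMap ≪≫ₗ
    (TensorProduct.lift.equiv (.id R) N (DoubleDual R M) R).symm ≪≫ₗ
    (LinearEquiv.congrRight (Module.evalEquiv R (Module.Dual R M)).symm) ≪≫ₗ
    (TensorProduct.lift.equiv (.id R) N M R) ≪≫ₗ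
    (TensorProduct.comm R M N).dualMap

end Rank

/-- Over a normal domain, a torsion-free module of rank one has only scalar endomorphisms. -/
theorem algebraMap_end_bijective {R : Type*} [CommRing R] [IsDomain R] [IsIntegrallyClosed R]
    {M : Type*} [AddCommGroup M] [Module R M] [Module.Finite R M] [Module.IsTorsionFree R M]
    (h : Module.finrank R M = 1) :
    Function.Bijective (Algebra.linearMap R (Module.End R M)) := by
  let K := FractionRing R
  let ι : M →ₗ[R] K ⊗[R] M := TensorProduct.mk R K M 1
  have hloc : IsLocalizedModule (nonZeroDivisors R) ι :=
    (isLocalizedModule_iff_isBaseChange (nonZeroDivisors R) K ι).2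
      (TensorProduct.isBaseChange R M K)
  have hι : Function.Injective ι := by
    rw [injective_iff_map_eq_zero]
    intro m hm
    obtain ⟨c, hc⟩ := (IsLocalizedModule.eq_zero_iff (nonZeroDivisors R) ι).1 hm
    exact (smul_eq_zero_iff_right (nonZeroDivisors.coe_ne_zero c)).1 hc
  have hK : Module.finrank K (K ⊗[R] M) = 1 := finrank_fractionRing_tensor.trans h
  have : Nontrivial M := Module.nontrivial_of_finrank_pos (R := R) (by omega)
  have : Nontrivial (K ⊗[R] M) := Module.nontrivial_of_finrank_pos (R := K) (by omega)
  constructor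
  · exact FaithfulSMul.algebraMap_injective R (Module.End R M)
  · intro f
    obtain ⟨c, hc, -⟩ :=
      LinearMap.existsUnique_eq_smul_id_of_finrank_eq_one hK (f.baseChange K)
    have h1 : IsIntegral R (Module.End.baseChangeHom R K M f) :=
      (Algebra.IsIntegral.isIntegral (R := R) f).map (Module.End.baseChangeHom R K M)
    have h2 : Module.End.baseChangeHom R K M f = algebraMap K (Module.End K (K ⊗[R] M)) c := by
      exact hc
    rw [h2, isIntegral_algebraMap_iff (FaithfulSMul.algebraMap_injective _ _)] at h1
    obtain ⟨r, hr⟩ := IsIntegrallyClosed.isIntegral_iff.1 h1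
    refine ⟨r, LinearMap.ext fun m => hι ?_⟩
    have h3 := LinearMap.congr_fun hc (ι m)
    simp only [ι, TensorProduct.mk_apply, LinearMap.baseChange_tmul, LinearMap.smul_apply,
      LinearMap.id_apply] at h3
    simp only [ι, TensorProduct.mk_apply, h3, ← hr, Algebra.linearMap_apply,
      Module.algebraMap_end_apply, algebraMap_smul, TensorProduct.tmul_smul]

/-- A reflexive module of rank one over `R`, living in the universe of `R`. -/
structure RankOneReflexive (R : Type u) [CommRing R] where
  carrier : Type u
  [addCommGroup : AddCommGroup carrier]
  [module : Module R carrier]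
  isReflexiveRankOne : IsReflexiveRankOne R carrier

attribute [instance] RankOneReflexive.addCommGroup RankOneReflexive.module

/-- The relation "isomorphic as `R`-modules". -/
instance RankOneReflexive.setoid (R : Type u) [CommRing R] : Setoid (RankOneReflexive R) where
  r M N := Nonempty (M.carrier ≃ₗ[R] N.carrier)
  iseqv := ⟨fun _ => ⟨.refl _ _⟩, fun ⟨e⟩ => ⟨e.symm⟩, fun ⟨e⟩ ⟨f⟩ => ⟨e ≪≫ₗ f⟩⟩

/-- The divisor class group: isomorphism classes of reflexive `R`-modules of rank one. -/
def Cl (R : Type u) [CommRing R] : Type (u + 1) :=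
  Quotient (RankOneReflexive.setoid R)

namespace Cl

/-- The class `[M]` of a reflexive `R`-module of rank one, in an arbitrary universe: as `M` is
finitely generated, it is isomorphic to a module in the universe of `R`. -/
noncomputable def mk (R : Type u) [CommRing R] (M : Type w) [AddCommGroup M] [Module R M]
    (h : IsReflexiveRankOne R M) : Cl R :=
  have := h.finite
  have : Small.{u} M := Module.Finite.small.{u} R M
  Quotient.mk _
    { carrier := Shrink.{u} M
      isReflexiveRankOne :=
        isReflexiveRankOne_of_equiv h (Shrink.linearEquiv R M).symm }

section

variable {R : Type u} [CommRing R]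

theorem mk_eq_mk_iff {M : Type v} [AddCommGroup M] [Module R M] {hM : IsReflexiveRankOne R M}
    {N : Type w} [AddCommGroup N] [Module R N] {hN : IsReflexiveRankOne R N} :
    mk R M hM = mk R N hN ↔ Nonempty (M ≃ₗ[R] N) := by
  have := hM.finite
  have := hN.finite
  have : Small.{u} M := Module.Finite.small.{u} R M
  have : Small.{u} N := Module.Finite.small.{u} R N
  let eM := Shrink.linearEquiv.{u} R M
  let eN := Shrink.linearEquiv.{u} R N
  refine Quotient.eq.trans ⟨fun ⟨e⟩ => ⟨eM.symm ≪≫ₗ e ≪≫ₗ eN⟩, fun ⟨e⟩ => ⟨eM ≪≫ₗ e ≪≫ₗ eN.symm⟩⟩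

theorem mk_carrier (M : RankOneReflexive R) :
    mk R M.carrier M.isReflexiveRankOne = Quotient.mk _ M := by
  have := M.isReflexiveRankOne.finite
  have : Small.{u} M.carrier := Module.Finite.small.{u} R M.carrier
  exact Quotient.sound ⟨Shrink.linearEquiv R M.carrier⟩

theorem exists_eq_mk (x : Cl R) :
    ∃ M : RankOneReflexive R, x = mk R M.carrier M.isReflexiveRankOne := by
  induction x using Quotient.inductionOn with
  | h M => exact ⟨M, (mk_carrier M).symm⟩

end

section Group

variable {R : Type u} [CommRing R] [IsDomain R]

/-- The identity is `[R]`. -/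
instance : One (Cl R) where
  one := Quotient.mk _ ⟨R, isReflexiveRankOne_self⟩

theorem mk_self : mk R R isReflexiveRankOne_self = 1 :=
  mk_carrier ⟨R, isReflexiveRankOne_self⟩

variable [IsNoetherianRing R]

theorem isReflexiveRankOne_mul {M : Type v} [AddCommGroup M] [Module R M]
    (hM : IsReflexiveRankOne R M) {N : Type w} [AddCommGroup N] [Module R N]
    (hN : IsReflexiveRankOne R N) : IsReflexiveRankOne R (DoubleDual R (M ⊗[R] N)) :=
  have := hM.finite
  have := hN.finite
  isReflexiveRankOne_doubleDual (by rw [finrank_tensor, hM.rank_one, hN.rank_one])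

theorem isReflexiveRankOne_inv {M : Type v} [AddCommGroup M] [Module R M]
    (hM : IsReflexiveRankOne R M) : IsReflexiveRankOne R (Module.Dual R M) :=
  have := hM.finite
  isReflexiveRankOne_dual hM.rank_one

/-- `[M] * [N] = [(M ⊗ N)**]`. -/
noncomputable instance : Mul (Cl R) where
  mul := Quotient.map₂
    (fun M N => ⟨DoubleDual R (M.carrier ⊗[R] N.carrier),
      isReflexiveRankOne_mul M.isReflexiveRankOne N.isReflexiveRankOne⟩)
    (fun _ _ ⟨e⟩ _ _ ⟨f⟩ => ⟨(TensorProduct.congr e f).dualMap.dualMap⟩)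

/-- `[M]⁻¹ = [M*]`. -/
noncomputable instance : Inv (Cl R) where
  inv := Quotient.map
    (fun M => ⟨Module.Dual R M.carrier, isReflexiveRankOne_inv M.isReflexiveRankOne⟩)
    (fun _ _ ⟨e⟩ => ⟨e.symm.dualMap⟩)

theorem mk_mul_mk {M : Type v} [AddCommGroup M] [Module R M] (hM : IsReflexiveRankOne R M)
    {N : Type w} [AddCommGroup N] [Module R N] (hN : IsReflexiveRankOne R N) :
    mk R M hM * mk R N hN =
      mk R (DoubleDual R (M ⊗[R] N)) (isReflexiveRankOne_mul hM hN) := by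
  have := hM.finite
  have := hN.finite
  have : Small.{u} M := Module.Finite.small.{u} R M
  have : Small.{u} N := Module.Finite.small.{u} R N
  let eM := Shrink.linearEquiv.{u} R M
  let eN := Shrink.linearEquiv.{u} R N
  refine (mk_carrier _).symm.trans (mk_eq_mk_iff.2 ?_)
  exact ⟨(TensorProduct.congr eM eN).dualMap.dualMap⟩

theorem inv_mk {M : Type v} [AddCommGroup M] [Module R M] (hM : IsReflexiveRankOne R M) :
    (mk R M hM)⁻¹ = mk R (Module.Dual R M) (isReflexiveRankOne_inv hM) := by
  have := hM.finite
  have : Small.{u} M := Module.Finite.small.{u} R M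
  let eM := Shrink.linearEquiv.{u} R M
  exact (mk_carrier _).symm.trans (mk_eq_mk_iff.2 ⟨eM.symm.dualMap⟩)

/-- The group law on the divisor class group of a Noetherian normal domain. -/
noncomputable instance [IsIntegrallyClosed R] : CommGroup (Cl R) where
  mul_assoc x y z := by
    obtain ⟨L, rfl⟩ := exists_eq_mk x
    obtain ⟨M, rfl⟩ := exists_eq_mk y
    obtain ⟨N, rfl⟩ := exists_eq_mk z
    have := L.isReflexiveRankOne.finite
    have := M.isReflexiveRankOne.finite
    have := N.isReflexiveRankOne.finite
    simp only [mk_mul_mk]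
    refine mk_eq_mk_iff.2 ⟨LinearEquiv.dualMap ?_⟩
    exact (TensorProduct.comm R (DoubleDual R (M.carrier ⊗[R] N.carrier)) L.carrier).dualMap ≪≫ₗ
      dualDoubleDualTensor ≪≫ₗ
      (TensorProduct.assoc R L.carrier M.carrier N.carrier ≪≫ₗ
        TensorProduct.comm R L.carrier (M.carrier ⊗[R] N.carrier)).dualMap ≪≫ₗ
      dualDoubleDualTensor.symm
  one_mul x := by
    obtain ⟨M, rfl⟩ := exists_eq_mk x
    have := M.isReflexiveRankOne.reflexive
    rw [← mk_self, mk_mul_mk]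
    exact mk_eq_mk_iff.2
      ⟨(TensorProduct.lid R M.carrier).dualMap.dualMap ≪≫ₗ (Module.evalEquiv R M.carrier).symm⟩
  mul_one x := by
    obtain ⟨M, rfl⟩ := exists_eq_mk x
    have := M.isReflexiveRankOne.reflexive
    rw [← mk_self, mk_mul_mk]
    exact mk_eq_mk_iff.2
      ⟨(TensorProduct.rid R M.carrier).dualMap.dualMap ≪≫ₗ (Module.evalEquiv R M.carrier).symm⟩
  mul_comm x y := by
    obtain ⟨M, rfl⟩ := exists_eq_mk x
    obtain ⟨N, rfl⟩ := exists_eq_mk y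
    rw [mk_mul_mk, mk_mul_mk]
    exact mk_eq_mk_iff.2 ⟨(TensorProduct.comm R M.carrier N.carrier).dualMap.dualMap⟩
  inv_mul_cancel x := by
    obtain ⟨M, rfl⟩ := exists_eq_mk x
    have hD := isReflexiveRankOne_inv M.isReflexiveRankOne
    have := hD.finite
    have := hD.reflexive
    rw [inv_mk, mk_mul_mk, ← mk_self]
    let e : R ≃ₗ[R] Module.Dual R (Module.Dual R M.carrier ⊗[R] M.carrier) :=
      LinearEquiv.ofBijective _ (algebraMap_end_bijective hD.rank_one) ≪≫ₗ
        TensorProduct.lift.equiv (.id R) (Module.Dual R M.carrier) M.carrier R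
    exact mk_eq_mk_iff.2 ⟨e.dualMap ≪≫ₗ LinearMap.ringLmapEquivSelf R R R⟩

end Group

end Cl

end DivisorClass

/-!
Divisibility in a Noetherian normal domain can be tested at the primes of height at most one. Hence
a homomorphism with torsion kernel whose cokernel is supported in codimension at least two induces
an isomorphism of duals. Near a prime `p` of `A` with `A_p` factorial, a reflexive module of rank
one is free: over a factorial ring, the functionals on a module of rank one are the multiples of a
single one. Thus for `T = M ⊗ N`, with `M` and `N` reflexive of rank one, the base change to `B` of
`T → T**` is an isomorphism near every prime of `B` of height at most one, so `B ⊗ T` and `B ⊗ T**`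
have the same dual, which is the multiplicativity of `[M] ↦ [(B ⊗ M)**]`.
-/

namespace DivisorClass

section CodimensionOne

variable {R : Type*} [CommRing R] [IsDomain R] [IsNoetherianRing R] [IsIntegrallyClosed R]

/-- If no such `t` and `u` existed, then `x / s` would multiply the finitely generated ideal `P`
into itself, hence be integral over `R`. -/
theorem exists_mul_eq_mul_of_mem_iff_dvd_mul {P : Ideal R} (hP : P ≠ ⊤) {s x : R} (hs : s ≠ 0)
    (hmem : ∀ b, b ∈ P ↔ s ∣ b * x) : ∃ t ∈ P, ∃ u ∉ P, t * x = s * u := by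
  by_contra! hcon
  let K := FractionRing R
  have hsK : algebraMap R K s ≠ 0 := by simpa using hs
  have hint : IsIntegral R (algebraMap R K x / algebraMap R K s) := by
    refine isIntegral_of_smul_mem_submodule (Submodule.map (Algebra.linearMap R K) P)
      ((Submodule.ne_bot_iff _).2 ⟨_, ⟨s, (hmem s).2 (dvd_mul_right s x), rfl⟩, hsK⟩)
      ((IsNoetherian.noetherian P).map _) _ ?_
    rintro _ ⟨b, hb, rfl⟩
    obtain ⟨c, hc⟩ := (hmem b).1 hb
    refine ⟨c, by_contra fun hcP => hcon b hb c hcP hc, ?_⟩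
    rw [Algebra.linearMap_apply, Algebra.linearMap_apply, smul_eq_mul, div_mul_eq_mul_div,
      eq_div_iff hsK, ← map_mul, ← map_mul, mul_comm x, hc, mul_comm]
  obtain ⟨r, hr⟩ := IsIntegrallyClosed.isIntegral_iff.1 hint
  have hsx : s ∣ x := ⟨r, IsFractionRing.injective R K (by rw [map_mul, hr, mul_div_cancel₀ _ hsK])⟩
  exact hP ((Ideal.eq_top_iff_one P).2 ((hmem 1).2 (by rwa [one_mul])))

theorem height_le_one_of_mem_iff_dvd_mul {P : Ideal R} [hP : P.IsPrime] {s x : R} (hs : s ≠ 0)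
    (hmem : ∀ b, b ∈ P ↔ s ∣ b * x) : P.height ≤ 1 := by
  obtain ⟨t, ht, u, hu, htu⟩ := exists_mul_eq_mul_of_mem_iff_dvd_mul hP.ne_top hs hmem
  have hmul_mem : ∀ z ∈ P, z * u ∈ Ideal.span {t} := fun z hz => by
    obtain ⟨w, hw⟩ := (hmem z).1 hz
    refine Ideal.mem_span_singleton.2 ⟨w, mul_left_cancel₀ hs ?_⟩
    linear_combination t * hw - z * htu
  refine Ideal.height_le_one_of_isPrincipal_of_mem_minimalPrimes (Ideal.span {t}) P
    ⟨⟨hP, (Ideal.span_singleton_le_iff_mem P).2 ht⟩, ?_⟩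
  rintro Q ⟨hQ, htQ⟩ hQP z hz
  exact (hQ.mem_or_mem (htQ (hmul_mem z hz))).resolve_right fun huQ => hu (hQP huQ)

theorem height_le_one_of_isAssociatedPrime_quotient_span_singleton {P : Ideal R} {s : R}
    (hs : s ≠ 0) (hP : IsAssociatedPrime P (R ⧸ Ideal.span {s})) : P.height ≤ 1 := by
  obtain ⟨hprime, y, hy⟩ := isAssociatedPrime_iff.1 hP
  obtain ⟨x, rfl⟩ := Ideal.Quotient.mk_surjective y
  refine height_le_one_of_mem_iff_dvd_mul hs (x := x) fun b => ?_
  rw [hy, Submodule.mem_colon_singleton, Submodule.mem_bot, ← Ideal.mem_span_singleton,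
    ← Ideal.Quotient.eq_zero_iff_mem, map_mul]
  rfl

theorem dvd_of_forall_height_le_one {s x : R} (hs : s ≠ 0)
    (h : ∀ P : PrimeSpectrum R, P.asIdeal.height ≤ 1 → ∃ b ∉ P.asIdeal, s ∣ b * x) : s ∣ x := by
  by_contra hx
  have hx' : Ideal.Quotient.mk (Ideal.span {s}) x ≠ 0 := by
    rwa [Ne, Ideal.Quotient.eq_zero_iff_mem, Ideal.mem_span_singleton]
  obtain ⟨P, hP, hle⟩ := exists_le_isAssociatedPrime_of_isNoetherianRing R _ hx'
  obtain ⟨b, hb, hbx⟩ := h ⟨P, hP.isPrime⟩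
    (height_le_one_of_isAssociatedPrime_quotient_span_singleton hs hP)
  refine hb (hle (Submodule.mem_colon_singleton.2 ?_))
  rwa [Submodule.mem_bot, Algebra.smul_def, Ideal.Quotient.algebraMap_eq, ← map_mul,
    Ideal.Quotient.eq_zero_iff_mem, Ideal.mem_span_singleton]

end CodimensionOne

section DualMap

variable {R : Type*} [CommRing R] [IsDomain R]
variable {X Y : Type*} [AddCommGroup X] [Module R X] [AddCommGroup Y] [Module R Y]

theorem notMem_support_quotient_range_iff {R : Type*} [CommRing R] [Module R X] [Module R Y]
    {f : X →ₗ[R] Y} {P : PrimeSpectrum R} :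
    P ∉ Module.support R (Y ⧸ LinearMap.range f) ↔ ∀ y, ∃ s ∉ P.asIdeal, ∃ x, f x = s • y := by
  simp only [Module.notMem_support_iff', (Submodule.Quotient.mk_surjective _).forall,
    ← Submodule.Quotient.mk_smul, Submodule.Quotient.mk_eq_zero, LinearMap.mem_range]

theorem dualMap_injective_of_bot_notMem_support {f : X →ₗ[R] Y}
    (hf : ⊥ ∉ Module.support R (Y ⧸ LinearMap.range f)) : Function.Injective f.dualMap := by
  rw [injective_iff_map_eq_zero]
  intro ψ hψ
  ext y
  obtain ⟨s, hs, x, hx⟩ := notMem_support_quotient_range_iff.1 hf y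
  have hsψ : s * ψ y = 0 := by
    rw [← smul_eq_mul, ← map_smul, ← hx]
    exact LinearMap.congr_fun hψ x
  exact (mul_eq_zero.1 hsψ).resolve_left hs

theorem mem_range_dualMap_of_bot_notMem_support {f : X →ₗ[R] Y}
    (hf : ⊥ ∉ Module.support R (Y ⧸ LinearMap.range f)) {ψ : Module.Dual R X}
    (hψ : ∀ y, ∃ r, ∀ s x, f x = s • y → ψ x = s * r) : ψ ∈ LinearMap.range f.dualMap := by
  have hgen := notMem_support_quotient_range_iff.1 hf
  choose χ hχ using hψ
  refine ⟨⟨⟨χ, fun y z => ?_⟩, fun c y => ?_⟩, LinearMap.ext fun x => ?_⟩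
  · obtain ⟨s, hs, x, hx⟩ := hgen y
    obtain ⟨s', hs', x', hx'⟩ := hgen z
    have hadd : f (s' • x + s • x') = (s * s') • (y + z) := by
      rw [map_add, map_smul, map_smul, hx, hx', smul_add, mul_smul, mul_smul, smul_comm s' s y]
    refine mul_left_cancel₀ (mul_ne_zero hs hs') ?_
    rw [← hχ _ _ _ hadd, map_add, map_smul, map_smul, hχ y s x hx, hχ z s' x' hx', smul_eq_mul,
      smul_eq_mul]
    ring
  · obtain ⟨s, hs, x, hx⟩ := hgen y
    have hsmul : f (c • x) = s • c • y := by rw [map_smul, hx, smul_comm]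
    refine mul_left_cancel₀ hs ?_
    rw [← hχ _ _ _ hsmul, map_smul, smul_eq_mul, hχ y s x hx, RingHom.id_apply, smul_eq_mul,
      mul_left_comm]
  · exact ((hχ (f x) 1 x (one_smul R _).symm).trans (one_mul _)).symm

theorem exists_smul_eq_of_forall_dvd {s : R} (hs : s ≠ 0) {ψ : Module.Dual R X}
    (h : ∀ x, s ∣ ψ x) : ∃ χ : Module.Dual R X, s • χ = ψ := by
  obtain ⟨χ, hχ⟩ := mem_range_dualMap_of_bot_notMem_support (f := s • LinearMap.id)
    (notMem_support_quotient_range_iff.2 fun x => ⟨s, hs, x, rfl⟩) (ψ := ψ) fun y => by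
      obtain ⟨r, hr⟩ := h y
      refine ⟨r, fun c x hx => mul_left_cancel₀ hs ?_⟩
      rw [← smul_eq_mul, ← map_smul]
      refine (congrArg ψ hx).trans ?_
      rw [map_smul, hr, smul_eq_mul, mul_left_comm]
  exact ⟨χ, by rw [← hχ]; ext x; exact (map_smul χ s x).symm⟩

theorem mul_apply_eq_mul_apply_of_ker_le_torsion {f : X →ₗ[R] Y}
    (hker : LinearMap.ker f ≤ Submodule.torsion R X) (ψ : Module.Dual R X) {x x' : X} {s s' : R}
    {y : Y} (hx : f x = s • y) (hx' : f x' = s' • y) : s' * ψ x = s * ψ x' := by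
  have hmem : s' • x - s • x' ∈ LinearMap.ker f := by
    rw [LinearMap.mem_ker, map_sub, map_smul, map_smul, hx, hx', smul_comm, sub_self]
  obtain ⟨c, hc⟩ := (Submodule.mem_torsion_iff _).1 (hker hmem)
  refine mul_left_cancel₀ (nonZeroDivisors.coe_ne_zero c) (sub_eq_zero.1 ?_)
  simpa [mul_sub, Submonoid.smul_def] using congrArg ψ hc

/-- If `f x = s • y` with `s ≠ 0`, the extension of `ψ` along `f` must take the value `ψ x / s` at
`y`. As `ker f` is torsion, this quotient does not depend on `(s, x)`; as `coker f` lives in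
codimension two, every prime of height one admits a choice with `s` outside it, so that the
quotient lies in `R`. -/
theorem dualMap_bijective_of_one_lt_height_of_mem_support [IsNoetherianRing R]
    [IsIntegrallyClosed R] {f : X →ₗ[R] Y} (hker : LinearMap.ker f ≤ Submodule.torsion R X)
    (hcoker : ∀ P ∈ Module.support R (Y ⧸ LinearMap.range f), 1 < P.asIdeal.height) :
    Function.Bijective f.dualMap := by
  have hbot : ⊥ ∉ Module.support R (Y ⧸ LinearMap.range f) := fun h => by
    simpa [PrimeSpectrum.asIdeal_bot] using hcoker ⊥ h
  refine ⟨dualMap_injective_of_bot_notMem_support hbot, fun ψ =>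
    mem_range_dualMap_of_bot_notMem_support hbot fun y => ?_⟩
  obtain ⟨s₀, hs₀, x₀, hx₀⟩ := notMem_support_quotient_range_iff.1 hbot y
  have hs₀ : s₀ ≠ 0 := hs₀
  obtain ⟨r, hr⟩ : s₀ ∣ ψ x₀ := dvd_of_forall_height_le_one hs₀ fun P hP => by
    obtain ⟨s, hs, x, hx⟩ :=
      notMem_support_quotient_range_iff.1 (fun h => (hcoker P h).not_ge hP) y
    exact ⟨s, hs, ψ x, mul_apply_eq_mul_apply_of_ker_le_torsion hker ψ hx₀ hx⟩
  refine ⟨r, fun s x hx => mul_left_cancel₀ hs₀ ?_⟩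
  rw [mul_apply_eq_mul_apply_of_ker_le_torsion hker ψ hx hx₀, hr, mul_left_comm]

end DualMap

section UpToScalar

variable {R M N M' N' : Type*} [CommRing R] [AddCommGroup M] [Module R M] [AddCommGroup N]
  [Module R N] [AddCommGroup M'] [Module R M'] [AddCommGroup N'] [Module R N']

/-- `f` and `g` are inverse to each other up to the scalar `t`. This says that `f` becomes an
isomorphism after inverting `t`, in a form that is preserved by linear functors, such as duals,
tensor products and base change, without reference to a localization. -/
structure IsInverseUpTo (t : R) (f : M →ₗ[R] N) (g : N →ₗ[R] M) : Prop where
  left : g ∘ₗ f = t • LinearMap.id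
  right : f ∘ₗ g = t • LinearMap.id

namespace IsInverseUpTo

variable {t t' : R} {f : M →ₗ[R] N} {g : N →ₗ[R] M} {f' : M' →ₗ[R] N'} {g' : N' →ₗ[R] M'}

theorem left_apply (h : IsInverseUpTo t f g) (m : M) : g (f m) = t • m :=
  LinearMap.congr_fun h.left m

theorem right_apply (h : IsInverseUpTo t f g) (n : N) : f (g n) = t • n :=
  LinearMap.congr_fun h.right n

theorem of_equiv (e : M ≃ₗ[R] N) : IsInverseUpTo (1 : R) e.toLinearMap e.symm.toLinearMap where
  left := by rw [e.symm_comp, one_smul]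
  right := by rw [e.comp_symm, one_smul]

theorem comp {P : Type*} [AddCommGroup P] [Module R P] {k : N →ₗ[R] P} {l : P →ₗ[R] N}
    (h' : IsInverseUpTo t' k l) (h : IsInverseUpTo t f g) :
    IsInverseUpTo (t' * t) (k ∘ₗ f) (g ∘ₗ l) where
  left := by
    ext m
    simp only [LinearMap.comp_apply, h'.left_apply, map_smul, h.left_apply, smul_smul,
      LinearMap.smul_apply, LinearMap.id_apply]
  right := by
    ext p
    simp only [LinearMap.comp_apply, h.right_apply, map_smul, h'.right_apply, smul_smul,
      LinearMap.smul_apply, LinearMap.id_apply, mul_comm t]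

theorem dualMap (h : IsInverseUpTo t f g) : IsInverseUpTo t g.dualMap f.dualMap where
  left := by rw [LinearMap.dualMap_comp_dualMap, h.left]; ext; simp
  right := by rw [LinearMap.dualMap_comp_dualMap, h.right]; ext; simp

theorem map (h : IsInverseUpTo t f g) (h' : IsInverseUpTo t' f' g') :
    IsInverseUpTo (t * t') (TensorProduct.map f f') (TensorProduct.map g g') where
  left := by
    rw [← TensorProduct.map_comp, h.left, h'.left, TensorProduct.map_smul_left,
      TensorProduct.map_smul_right, TensorProduct.map_id, smul_smul]
  right := by
    rw [← TensorProduct.map_comp, h.right, h'.right, TensorProduct.map_smul_left,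
      TensorProduct.map_smul_right, TensorProduct.map_id, smul_smul]

theorem baseChange (S : Type*) [CommRing S] [Algebra R S] (h : IsInverseUpTo t f g) :
    IsInverseUpTo (algebraMap R S t) (f.baseChange S) (g.baseChange S) where
  left := by
    rw [← LinearMap.baseChange_comp, h.left, LinearMap.baseChange_smul, LinearMap.baseChange_id,
      algebraMap_smul]
  right := by
    rw [← LinearMap.baseChange_comp, h.right, LinearMap.baseChange_smul, LinearMap.baseChange_id,
      algebraMap_smul]

theorem eval [Module.IsReflexive R N] (h : IsInverseUpTo t f g) :
    IsInverseUpTo t (Module.Dual.eval R M)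
      (g ∘ₗ (Module.evalEquiv R N).symm ∘ₗ f.dualMap.dualMap) where
  left := by
    ext m
    have hf : f.dualMap.dualMap (Module.Dual.eval R M m) = Module.evalEquiv R N (f m) := rfl
    simp only [LinearMap.comp_apply, LinearEquiv.coe_coe, hf, LinearEquiv.symm_apply_apply,
      h.left_apply, LinearMap.smul_apply, LinearMap.id_apply]
  right := by
    refine LinearMap.ext fun ξ => ?_
    have hg : ∀ n, Module.Dual.eval R M (g n) = g.dualMap.dualMap (Module.evalEquiv R N n) :=
      fun _ => rfl
    simp only [LinearMap.comp_apply, LinearEquiv.coe_coe, hg, LinearEquiv.apply_symm_apply,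
      h.dualMap.dualMap.left_apply, LinearMap.smul_apply, LinearMap.id_apply]

theorem bijective (h : IsInverseUpTo t f g) (ht : IsUnit t) : Function.Bijective f := by
  refine ⟨fun m m' hm => ht.smul_left_cancel.1 ?_, fun n => ?_⟩
  · rw [← h.left_apply, ← h.left_apply, hm]
  · obtain ⟨n', rfl⟩ := ht.smul_bijective.2 n
    exact ⟨g n', h.right_apply n'⟩

theorem notMem_support_coker (h : IsInverseUpTo t f g) {P : PrimeSpectrum R}
    (ht : t ∉ P.asIdeal) : P ∉ Module.support R (N ⧸ LinearMap.range f) :=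
  notMem_support_quotient_range_iff.2 fun n => ⟨t, ht, g n, h.right_apply n⟩

variable [IsDomain R]

theorem ker_le_torsion (h : IsInverseUpTo t f g) (ht : t ≠ 0) :
    LinearMap.ker f ≤ Submodule.torsion R M := fun m hm =>
  (Submodule.mem_torsion_iff m).2 ⟨⟨t, mem_nonZeroDivisors_of_ne_zero ht⟩, by
    rw [Submonoid.mk_smul, ← h.left_apply, LinearMap.mem_ker.1 hm, map_zero]⟩

theorem finrank_eq (h : IsInverseUpTo t f g) (ht : t ≠ 0) :
    Module.finrank R M = Module.finrank R N := by
  have htK : IsUnit (algebraMap R (FractionRing R) t) := IsUnit.mk0 _ (by simpa using ht)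
  rw [← finrank_fractionRing_tensor (M := M), ← finrank_fractionRing_tensor (M := N)]
  exact (LinearEquiv.ofBijective _ ((h.baseChange (FractionRing R)).bijective htK)).finrank_eq

end IsInverseUpTo

theorem exists_isInverseUpTo_of_localization_equiv (S : Submonoid R)
    [Module.FinitePresentation R M] [Module.FinitePresentation R N]
    (u : M →ₗ[R] M') [IsLocalizedModule S u] (v : N →ₗ[R] N') [IsLocalizedModule S v]
    (e : M' ≃ₗ[R] N') :
    ∃ t ∈ S, ∃ (f : M →ₗ[R] N) (g : N →ₗ[R] M), IsInverseUpTo t f g := by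
  obtain ⟨f, s, hf⟩ := Module.FinitePresentation.exists_lift_of_isLocalizedModule S v (e ∘ₗ u)
  obtain ⟨g, s', hg⟩ := Module.FinitePresentation.exists_lift_of_isLocalizedModule S u
    (e.symm ∘ₗ v)
  have hf_apply (m : M) : v (f m) = (s : R) • e (u m) := LinearMap.congr_fun hf m
  have hg_apply (n : N) : u (g n) = (s' : R) • e.symm (v n) := LinearMap.congr_fun hg n
  obtain ⟨c, hc⟩ := Module.Finite.exists_smul_of_comp_eq_of_isLocalizedModule S u (g ∘ₗ f)
    ((s * s' : R) • LinearMap.id) (by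
      ext m
      simp only [LinearMap.comp_apply, LinearMap.smul_apply, LinearMap.id_apply, map_smul, hg_apply,
        hf_apply, e.symm_apply_apply, smul_smul, mul_comm])
  obtain ⟨c', hc'⟩ := Module.Finite.exists_smul_of_comp_eq_of_isLocalizedModule S v (f ∘ₗ g)
    ((s * s' : R) • LinearMap.id) (by
      ext n
      simp only [LinearMap.comp_apply, LinearMap.smul_apply, LinearMap.id_apply, map_smul, hg_apply,
        hf_apply, e.apply_symm_apply, smul_smul])
  rw [Submonoid.smul_def, Submonoid.smul_def] at hc hc'
  refine ⟨c * c' * (s * s'), (c * c' * (s * s')).2, f, (c * c' : R) • g, ?_, ?_⟩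
  · rw [LinearMap.smul_comp, mul_comm (c : R), mul_smul, hc, smul_smul, smul_smul, mul_assoc]
  · rw [LinearMap.comp_smul, mul_smul, hc', smul_smul, smul_smul, mul_assoc]

end UpToScalar

section RankOne

variable {R M : Type*} [CommRing R] [AddCommGroup M] [Module R M]

theorem exists_forall_dvd_mul_apply_iff [UniqueFactorizationMonoid R] [Module.Finite R M]
    (φ : Module.Dual R M) :
    ∃ d : R, ∀ x y, (∀ m, y ∣ x * φ m) ↔ y ∣ x * d := by
  classical
  let := UniqueFactorizationMonoid.strongNormalizationMonoid (α := R)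
  let := UniqueFactorizationMonoid.toNormalizedGCDMonoid R
  obtain ⟨G, hG⟩ := Module.Finite.fg_top (R := R) (M := M)
  have hdvd (m : M) : G.gcd φ ∣ φ m := by
    have hle : Submodule.span R G ≤ Submodule.comap φ (Ideal.span {G.gcd φ}) :=
      Submodule.span_le.2 fun m hm => Ideal.mem_span_singleton.2 (Finset.gcd_dvd hm)
    exact Ideal.mem_span_singleton.1 (hle (hG ▸ Submodule.mem_top))
  refine ⟨G.gcd φ, fun x y => ⟨fun h => ?_, fun h m => h.trans (mul_dvd_mul_left x (hdvd m))⟩⟩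
  exact (Finset.dvd_gcd fun m _ => h m).trans (Finset.gcd_mul_left' G φ x).dvd

variable [IsDomain R]

theorem dual_apply_mul_apply_comm (h : Module.finrank R M = 1) (φ ψ : Module.Dual R M) (m n : M) :
    φ m * ψ n = ψ m * φ n := by
  have hdep : ¬ LinearIndependent R ![m, n] := fun hli => by
    simpa [Module.rank_eq_one_iff_finrank_eq_one.2 h] using hli.cardinal_lift_le_rank
  simp only [LinearIndependent.pair_iff, not_forall] at hdep
  obtain ⟨a, b, hab, hne⟩ := hdep
  have hφ : a * φ m + b * φ n = 0 := by simpa using congrArg φ hab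
  have hψ : a * ψ m + b * ψ n = 0 := by simpa using congrArg ψ hab
  by_cases ha : a = 0
  · exact mul_left_cancel₀ (fun hb => hne ⟨ha, hb⟩) (by linear_combination φ m * hψ - ψ m * hφ)
  · exact mul_left_cancel₀ ha (by linear_combination ψ n * hφ - φ n * hψ)

variable [UniqueFactorizationMonoid R] [Module.Finite R M]

/-- A generator is obtained by dividing a nonzero functional by the greatest common divisor of its
values. -/
theorem exists_forall_dual_eq_smul (h : Module.finrank R M = 1) :
    ∃ χ : Module.Dual R M, ∀ ψ : Module.Dual R M, ∃ a : R, a • χ = ψ := by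
  by_cases hzero : ∀ φ : Module.Dual R M, φ = 0
  · exact ⟨0, fun ψ => ⟨0, by rw [hzero ψ, smul_zero]⟩⟩
  obtain ⟨φ, hφ⟩ := not_forall.1 hzero
  obtain ⟨m₁, hm₁⟩ : ∃ m₁, φ m₁ ≠ 0 := by simpa [LinearMap.ext_iff] using hφ
  obtain ⟨d, hd⟩ := exists_forall_dvd_mul_apply_iff φ
  have hdφ (m : M) : d ∣ φ m := by simpa using (hd 1 d).2 (by rw [one_mul]) m
  have hd₀ : d ≠ 0 := fun h₀ => hm₁ (zero_dvd_iff.1 (h₀ ▸ hdφ m₁))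
  obtain ⟨χ, rfl⟩ := exists_smul_eq_of_forall_dvd hd₀ hdφ
  refine ⟨χ, fun ψ => ?_⟩
  obtain ⟨a, ha⟩ : (d • χ) m₁ ∣ ψ m₁ * d :=
    (hd _ _).1 fun m => ⟨ψ m, dual_apply_mul_apply_comm h ψ (d • χ) m₁ m⟩
  refine ⟨a, LinearMap.ext fun m => mul_left_cancel₀ (mul_ne_zero hd₀ hm₁) ?_⟩
  have hcomm := dual_apply_mul_apply_comm h (d • χ) ψ m₁ m
  simp only [LinearMap.smul_apply, smul_eq_mul] at ha hcomm ⊢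
  linear_combination -d * χ m * ha - d * hcomm

theorem nonempty_equiv_dual [IsNoetherianRing R] (h : Module.finrank R M = 1) :
    Nonempty (R ≃ₗ[R] Module.Dual R M) := by
  obtain ⟨χ, hχ⟩ := exists_forall_dual_eq_smul h
  have : Nontrivial (Module.Dual R M) :=
    Module.nontrivial_of_finrank_pos (R := R) (by rw [finrank_dual, h]; exact one_pos)
  have hχ₀ : χ ≠ 0 := by
    rintro rfl
    obtain ⟨ψ, hψ⟩ := exists_ne (0 : Module.Dual R M)
    obtain ⟨a, rfl⟩ := hχ ψ
    exact hψ (smul_zero a)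
  exact ⟨.ofBijective (LinearMap.toSpanSingleton R _ χ) ⟨smul_left_injective R hχ₀, hχ⟩⟩

end RankOne

section FreeRankOneNear

/-- `M` is free of rank one in a neighbourhood of `p`: some `t ∉ p` makes `M` isomorphic to `R`
up to the scalar `t`. In contrast to freeness of the localization `M_p`, this does not involve
modules over another ring. -/
def IsFreeRankOneNear {R : Type*} [CommRing R] (p : PrimeSpectrum R) (M : Type*) [AddCommGroup M]
    [Module R M] : Prop :=
  ∃ t ∉ p.asIdeal, ∃ (f : M →ₗ[R] R) (g : R →ₗ[R] M), IsInverseUpTo t f g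

variable {R M N : Type*} [CommRing R] [AddCommGroup M] [Module R M] [AddCommGroup N] [Module R N]
  {p : PrimeSpectrum R}

theorem IsFreeRankOneNear.of_equiv (hM : IsFreeRankOneNear p M) (e : N ≃ₗ[R] M) :
    IsFreeRankOneNear p N := by
  obtain ⟨t, ht, f, g, h⟩ := hM
  exact ⟨t * 1, by rwa [mul_one], _, _, h.comp (.of_equiv e)⟩

theorem IsFreeRankOneNear.tensor (hM : IsFreeRankOneNear p M) (hN : IsFreeRankOneNear p N) :
    IsFreeRankOneNear p (M ⊗[R] N) := by
  obtain ⟨t, ht, f, g, h⟩ := hM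
  obtain ⟨t', ht', f', g', h'⟩ := hN
  refine ⟨1 * (t * t'), ?_, _, _, (IsInverseUpTo.of_equiv (TensorProduct.lid R R)).comp (h.map h')⟩
  rw [one_mul]
  exact p.isPrime.mul_notMem ht ht'

theorem IsFreeRankOneNear.finrank_baseChange {S : Type*} [CommRing S] [IsDomain S] [Algebra R S]
    (hM : IsFreeRankOneNear (PrimeSpectrum.comap (algebraMap R S) ⊥) M) :
    Module.finrank S (S ⊗[R] M) = 1 := by
  obtain ⟨t, ht, f, g, h⟩ := hM
  rw [(h.baseChange S).finrank_eq ht, (AlgebraTensorModule.rid R S S).finrank_eq,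
    Module.finrank_self]

variable [IsDomain R] [IsNoetherianRing R]

theorem isFreeRankOneNear_dual_of_mem_UFDLocus [Module.Finite R M] (hM : Module.finrank R M = 1)
    (hp : p ∈ UFDLocus R) : IsFreeRankOneNear p (Module.Dual R M) := by
  let S := p.asIdeal.primeCompl
  let Rp := Localization.AtPrime p.asIdeal
  let ι := LocalizedModule.mkLinearMap S M
  have hS : S ≤ nonZeroDivisors R := p.asIdeal.primeCompl_le_nonZeroDivisors
  have : UniqueFactorizationMonoid Rp := hp
  have : IsDomain Rp := IsLocalization.isDomain_localization hS
  have : IsNoetherianRing Rp := IsLocalization.isNoetherianRing S Rp inferInstance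
  have := Module.finitePresentation_of_finite R M
  have := finite_dual (R := R) (M := M)
  have := Module.finitePresentation_of_finite R (Module.Dual R M)
  have : Module.Finite Rp (LocalizedModule S M) := Module.Finite.of_isLocalizedModule S ι
  have hMp : Module.finrank Rp (LocalizedModule S M) = 1 := by
    rw [IsLocalization.finrank_eq Rp S hS, IsLocalizedModule.finrank_eq S ι hS, hM]
  obtain ⟨e⟩ := nonempty_equiv_dual hMp
  exact exists_isInverseUpTo_of_localization_equiv S
    (IsLocalizedModule.mapExtendScalars S ι (Algebra.linearMap R Rp) Rp)
    (Algebra.linearMap R Rp) (e.symm.restrictScalars R)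

theorem IsReflexiveRankOne.isFreeRankOneNear (hM : IsReflexiveRankOne R M)
    (hp : p ∈ UFDLocus R) : IsFreeRankOneNear p M :=
  have := hM.finite
  have := hM.reflexive
  have hD := isReflexiveRankOne_dual hM.rank_one
  have := hD.finite
  (isFreeRankOneNear_dual_of_mem_UFDLocus hD.rank_one hp).of_equiv (Module.evalEquiv R M)

end FreeRankOneNear

/-- The dual of `M ⊗ N` does not change when both factors are replaced by their double duals. -/
noncomputable def dualDoubleDualTensorDoubleDual {R M N : Type*} [CommRing R] [IsDomain R]
    [IsNoetherianRing R] [AddCommGroup M] [Module R M] [Module.Finite R M] [AddCommGroup N]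
    [Module R N] [Module.Finite R N] :
    Module.Dual R (DoubleDual R M ⊗[R] DoubleDual R N) ≃ₗ[R] Module.Dual R (M ⊗[R] N) :=
  dualDoubleDualTensor ≪≫ₗ (TensorProduct.comm R (DoubleDual R N) M).dualMap ≪≫ₗ
    dualDoubleDualTensor ≪≫ₗ (TensorProduct.comm R M N).dualMap

section BaseChange

variable {A : Type u} {B : Type v} [CommRing A] [CommRing B] [IsDomain B] [IsNoetherianRing B]
  [Algebra A B]

theorem dualMap_baseChange_eval_bijective [IsIntegrallyClosed B] {T : Type*} [AddCommGroup T]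
    [Module A T]
    (hT : ∀ P : PrimeSpectrum B, P.asIdeal.height ≤ 1 →
      IsFreeRankOneNear (PrimeSpectrum.comap (algebraMap A B) P) T) :
    Function.Bijective ((Module.Dual.eval A T).baseChange B).dualMap := by
  refine dualMap_bijective_of_one_lt_height_of_mem_support ?_ fun P hP => ?_
  · obtain ⟨t, ht, f, g, h⟩ := hT ⊥ (by simp [PrimeSpectrum.asIdeal_bot])
    exact (h.eval.baseChange B).ker_le_torsion ht
  · by_contra! hle
    obtain ⟨t, ht, f, g, h⟩ := hT P hle
    exact (h.eval.baseChange B).notMem_support_coker ht hP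

variable [IsDomain A] [IsNoetherianRing A]

theorem isReflexiveRankOne_baseChange
    (h : PrimeSpectrum.comap (algebraMap A B) ⊥ ∈ UFDLocus A)
    {M : Type*} [AddCommGroup M] [Module A M] (hM : IsReflexiveRankOne A M) :
    IsReflexiveRankOne B (DoubleDual B (B ⊗[A] M)) :=
  have := hM.finite
  isReflexiveRankOne_doubleDual (hM.isFreeRankOneNear h).finrank_baseChange

variable [IsIntegrallyClosed B]

theorem nonempty_dual_baseChange_doubleDual_tensor_equiv
    (hUFD : ∀ P : PrimeSpectrum B, P.asIdeal.height ≤ 1 →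
      PrimeSpectrum.comap (algebraMap A B) P ∈ UFDLocus A)
    {M : Type*} [AddCommGroup M] [Module A M] (hM : IsReflexiveRankOne A M)
    {N : Type*} [AddCommGroup N] [Module A N] (hN : IsReflexiveRankOne A N) :
    Nonempty (Module.Dual B (B ⊗[A] DoubleDual A (M ⊗[A] N)) ≃ₗ[B]
      Module.Dual B (DoubleDual B (B ⊗[A] M) ⊗[B] DoubleDual B (B ⊗[A] N))) :=
  have := hM.finite
  have := hN.finite
  have hbij := dualMap_baseChange_eval_bijective (T := M ⊗[A] N) fun P hP =>
    (hM.isFreeRankOneNear (hUFD P hP)).tensor (hN.isFreeRankOneNear (hUFD P hP))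
  ⟨LinearEquiv.ofBijective _ hbij ≪≫ₗ
    (AlgebraTensorModule.distribBaseChange A B M N).symm.dualMap ≪≫ₗ
    dualDoubleDualTensorDoubleDual.symm⟩

variable [IsIntegrallyClosed A]

/-- The homomorphism `Cl(φ)` of divisor class groups induced by reflexive base change
`[M] ↦ [(B ⊗ M)**]` along `φ : A → B`. -/
noncomputable def Cl.map
    (hUFD : ∀ P : PrimeSpectrum B, P.asIdeal.height ≤ 1 →
      PrimeSpectrum.comap (algebraMap A B) P ∈ UFDLocus A) : Cl A →* Cl B :=
  have hgen := hUFD ⊥ (by simp [PrimeSpectrum.asIdeal_bot])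
  MonoidHom.mk'
    (Quotient.lift
      (fun M : RankOneReflexive A =>
        Cl.mk B _ (isReflexiveRankOne_baseChange hgen M.isReflexiveRankOne))
      fun _ _ ⟨e⟩ => Cl.mk_eq_mk_iff.2 ⟨(e.baseChange A B _ _).dualMap.dualMap⟩)
    (Quotient.ind₂ fun M N => by
      obtain ⟨e⟩ := nonempty_dual_baseChange_doubleDual_tensor_equiv hUFD M.isReflexiveRankOne
        N.isReflexiveRankOne
      exact (Cl.mk_eq_mk_iff.2 ⟨e.symm.dualMap⟩).trans (Cl.mk_mul_mk _ _).symm)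

theorem Cl.map_mk
    (hUFD : ∀ P : PrimeSpectrum B, P.asIdeal.height ≤ 1 →
      PrimeSpectrum.comap (algebraMap A B) P ∈ UFDLocus A)
    {M : Type w} [AddCommGroup M] [Module A M] (hM : IsReflexiveRankOne A M)
    (hN : IsReflexiveRankOne B (DoubleDual B (B ⊗[A] M))) :
    Cl.map hUFD (Cl.mk A M hM) = Cl.mk B (DoubleDual B (B ⊗[A] M)) hN := by
  have := hM.finite
  have : Small.{u} M := Module.Finite.small.{u} A M
  let e := Shrink.linearEquiv.{u} A M
  have hS := isReflexiveRankOne_baseChange (hUFD ⊥ (by simp [PrimeSpectrum.asIdeal_bot]))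
    (isReflexiveRankOne_of_equiv hM e.symm)
  exact (Cl.mk_eq_mk_iff (hM := hS)).2 ⟨(e.baseChange A B _ _).dualMap.dualMap⟩

end BaseChange

end DivisorClass

theorem mainTheorem3 {A : Type u} {B : Type v}
    [CommRing A] [IsDomain A] [IsNoetherianRing A] [IsIntegrallyClosed A]
    [CommRing B] [IsDomain B] [IsNoetherianRing B] [IsIntegrallyClosed B]
    [Algebra A B]
    (hUFD : ∀ P : PrimeSpectrum B, P.asIdeal.height ≤ 1 →
      PrimeSpectrum.comap (algebraMap A B) P ∈ DivisorClass.UFDLocus A) :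
    ∃! f : DivisorClass.Cl A →* DivisorClass.Cl B,
      ∀ (M : Type u) [AddCommGroup M] [Module A M] (hM : DivisorClass.IsReflexiveRankOne A M),
        ∃ hN : DivisorClass.IsReflexiveRankOne B (DivisorClass.DoubleDual B (B ⊗[A] M)),
          f (DivisorClass.Cl.mk A M hM) =
            DivisorClass.Cl.mk B (DivisorClass.DoubleDual B (B ⊗[A] M)) hN := by
  have hgen := hUFD ⊥ (by simp [PrimeSpectrum.asIdeal_bot])
  refine ⟨DivisorClass.Cl.map hUFD, fun M _ _ hM =>
    ⟨DivisorClass.isReflexiveRankOne_baseChange hgen hM, DivisorClass.Cl.map_mk hUFD hM _⟩,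
    fun f hf => MonoidHom.ext fun x => ?_⟩
  obtain ⟨M, rfl⟩ := DivisorClass.Cl.exists_eq_mk x
  obtain ⟨hN, hfM⟩ := hf M.carrier M.isReflexiveRankOne
  rw [hfM, DivisorClass.Cl.map_mk hUFD M.isReflexiveRankOne hN]
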